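/- **Theorem 1.** Let $\rho$ be a state (positive trace-one operator) of one bosonic mode with photon-number operator $\hat N=\hat a^\dagger\hat a$, let $h\ge 0$ be an integer such that the $(h+1)$-th photon-number moment $\mathrm{Tr}(\rho\,\hat N^{h+1})=\sum_N N^{h+1}\langle N|\rho|N\rangle$ is finite, and let $c$ be a real number. Then there is a constant $C$, depending only on $\rho$, $h$ and $c$, with the following property. Consider any multiplexed PNR detector with $n\ge 1$ ON-OFF detectors: a lossless passive linear interferometer with vacuum in all its ancillary input ports sends a portion $\eta_j$ of the light to the $j$-th ON-OFF detector, where $\eta_j\le c/n$ for all $j$ (possibly some light leaves through an unmonitored port, so $\sum_j\eta_j\le 1$); the $j$-th ON-OFF detector has efficiency $\kappa_j\in[0,1]$, and all have the same dark count probability $\varepsilon\in[0,1]$, so that its "OFF" POVM element is $(1-\varepsilon)\sum_N(1-\kappa_j)^N|N\rangle\langle N|$. Let $K$ be the number of detectors that click. Let $M$ be the outcome of a PNR detector of efficiency $\bar\kappa=\sum_{j=1}^n\kappa_j\eta_j$ (it counts $k$ out of $N$ photons with probability $\binom Nk\bar\kappa^k(1-\bar\kappa)^{N-k}$), applied to $\rho$,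 plus an independent dark count with binomial distribution of parameters $(n,\varepsilon)$, whose mean is $\bar\varepsilon=n\varepsilon$. Then $\mathbb E[M^h]$ is finite and $$\bigl|\mathbb E[K^h]-\mathbb E[M^h]\bigr|\le \frac{C\,(1+\bar\varepsilon)^h}{n}.$$ In particular, as long as the mean dark count $\bar\varepsilon$ stays bounded, the approximation error is $O(1/n)$; this holds for every moment if all photon-number moments of $\rho$ are finite. -/

import Mathlib

namespace MPNR

noncomputable section

/-! ## Fock spaces and states -/

/-- The Fock space in the occupation-number representation: `ℓ²(X, ℂ)`, where
`X` is the set of labels of the number basis. One mode is `X = ℕ`; modes indexed by `ι` are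
`X = (ι → ℕ)`. -/
abbrev Fock (X : Type) : Type := lp (fun _ : X => ℂ) 2

open Classical in
/-- The number-basis vector `|x⟩`. -/
def ket {X : Type} (x : X) : Fock X := lp.single 2 x (1 : ℂ)

/-- The diagonal matrix element `⟨x| A |x⟩` (a real number when `A` is self-adjoint). -/
def diagEntry {X : Type} (A : Fock X →L[ℂ] Fock X) (x : X) : ℝ :=
  RCLike.re (inner ℂ (ket x) (A (ket x)))

/-- `Tr (A E)` for the observable `E = ∑ x, e x • |x⟩⟨x|` that is diagonal in the number basis.
With `A` a density operator and `e` the diagonal of a POVM element, this is the Born rule. -/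
def traceDiag {X : Type} (A : Fock X →L[ℂ] Fock X) (e : X → ℝ) : ℝ :=
  ∑' x, diagEntry A x * e x

/-- A quantum state of a single bosonic mode: a positive operator of trace one. -/
structure State where
  /-- the density operator -/
  op : Fock ℕ →L[ℂ] Fock ℕ
  pos : op.IsPositive
  trace_one : HasSum (diagEntry op) 1

/-- The `h`-th moment of the photon number, `Tr (ρ (a† a) ^ h)`, is finite. -/
def State.FiniteMoment (ρ : State) (h : ℕ) : Prop :=
  Summable fun N : ℕ => (N : ℝ) ^ h * diagEntry ρ.op N

/-! ## Splitting the light -/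

/-- A lossless passive linear interferometer with output ports `ι` whose only non-vacuum input is
the signal mode `a`; it acts as `a† ↦ ∑ j, amp j • a_j†`, so `amp` is the column of the unitary
matrix of the interferometer that belongs to the signal. -/
structure Splitter (ι : Type) [Fintype ι] where
  /-- the amplitude sent to each port -/
  amp : ι → ℂ
  lossless : ∑ j, ‖amp j‖ ^ 2 = 1

/-- The portion `η_j` of the light that is sent to the port `j`. -/
def Splitter.ratio {ι : Type} [Fintype ι] (u : Splitter ι) (j : ι) : ℝ := ‖u.amp j‖ ^ 2

/-- The amplitude `⟨m| (∑ j, amp j • a_j†) ^ N |vac⟩ / √N!` with `N = ∑ j, m j`, that is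
`√(N! / ∏ j, (m j)!) * ∏ j, amp j ^ m j`. -/
def Splitter.coeff {ι : Type} [Fintype ι] (u : Splitter ι) (m : ι → ℕ) : ℂ :=
  ((Real.sqrt (Nat.multinomial Finset.univ m) : ℝ) : ℂ) * ∏ j, u.amp j ^ m j

lemma Splitter.sum_fiber {ι : Type} [Fintype ι] (u : Splitter ι) (N : ℕ) :
    HasSum (fun m : {m : ι → ℕ // ∑ j, m j = N} => ‖u.coeff m.1‖ ^ 2) 1 := by
  classical
  let e : {m : ι → ℕ // ∑ j, m j = N} ≃ (Finset.univ : Finset ι).piAntidiag N :=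
    Equiv.subtypeEquivRight fun m => by simp
  have key : ∑ m ∈ (Finset.univ : Finset ι).piAntidiag N, ‖u.coeff m‖ ^ 2 = 1 := by
    have h := Finset.sum_pow_eq_sum_piAntidiag (Finset.univ : Finset ι)
      (fun j => ‖u.amp j‖ ^ 2) N
    rw [u.lossless, one_pow] at h
    rw [h]
    refine Finset.sum_congr rfl fun m _ => ?_
    rw [Splitter.coeff, norm_mul, mul_pow, Complex.norm_real, Real.norm_eq_abs, sq_abs,
      Real.sq_sqrt (Nat.cast_nonneg _), norm_prod, ← Finset.prod_pow]
    congr 1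
    refine Finset.prod_congr rfl fun j _ => ?_
    rw [norm_pow, ← pow_mul, ← pow_mul, mul_comm]
  have h2 : HasSum (fun m : (Finset.univ : Finset ι).piAntidiag N => ‖u.coeff m.1‖ ^ 2) 1 := by
    rw [← key]
    exact Finset.hasSum _ (fun m => ‖u.coeff m‖ ^ 2)
  exact e.hasSum_iff.mpr h2

lemma Splitter.hasSum_norm_sq {ι : Type} [Fintype ι] (u : Splitter ι) (ψ : Fock ℕ) :
    HasSum (fun m : ι → ℕ => ‖u.coeff m * ψ (∑ j, m j)‖ ^ 2) (‖ψ‖ ^ 2) := by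
  have hψ : HasSum (fun N : ℕ => ‖ψ N‖ ^ 2) (‖ψ‖ ^ 2) := by
    simpa using lp.hasSum_norm (p := 2) (by norm_num) ψ
  have hf : ∀ N : ℕ, HasSum (fun m : {m : ι → ℕ // ∑ j, m j = N} =>
      ‖u.coeff m.1 * ψ (∑ j, m.1 j)‖ ^ 2) (‖ψ N‖ ^ 2) := by
    intro N
    have h := (u.sum_fiber N).mul_right (‖ψ N‖ ^ 2)
    rw [one_mul] at h
    have heq : (fun m : {m : ι → ℕ // ∑ j, m j = N} => ‖u.coeff m.1 * ψ (∑ j, m.1 j)‖ ^ 2) =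
        fun m => ‖u.coeff m.1‖ ^ 2 * ‖ψ N‖ ^ 2 := by
      funext m
      rw [m.2, norm_mul, mul_pow]
    rw [heq]
    exact h
  let e := Equiv.sigmaFiberEquiv (fun m : ι → ℕ => ∑ j, m j)
  rw [← e.hasSum_iff]
  have hs : Summable ((fun m : ι → ℕ => ‖u.coeff m * ψ (∑ j, m j)‖ ^ 2) ∘ e) := by
    rw [summable_sigma_of_nonneg (fun _ => by simp only [Function.comp_apply]; positivity)]
    refine ⟨fun N => (hf N).summable, ?_⟩
    refine hψ.summable.congr fun N => ?_
    exact (hf N).tsum_eq.symm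
  have := hs.hasSum.sigma (g := fun N => ‖ψ N‖ ^ 2) hf
  rw [← this.unique hψ]
  exact hs.hasSum

/-- The image of a vector under the splitter, `(V ψ) m = coeff m * ψ (∑ j, m j)`. -/
def Splitter.image {ι : Type} [Fintype ι] (u : Splitter ι) (ψ : Fock ℕ) : Fock (ι → ℕ) :=
  ⟨fun m => u.coeff m * ψ (∑ j, m j), memℓp_gen (by simpa using (u.hasSum_norm_sq ψ).summable)⟩

lemma Splitter.norm_image {ι : Type} [Fintype ι] (u : Splitter ι) (ψ : Fock ℕ) :
    ‖u.image ψ‖ = ‖ψ‖ := by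
  have h : HasSum (fun m : ι → ℕ => ‖u.coeff m * ψ (∑ j, m j)‖ ^ 2) (‖u.image ψ‖ ^ 2) := by
    have h0 := lp.hasSum_norm (p := 2) (by norm_num) (u.image ψ)
    simp only [ENNReal.toReal_ofNat, Real.rpow_ofNat] at h0
    exact h0
  exact (sq_eq_sq₀ (norm_nonneg _) (norm_nonneg _)).mp (h.unique (u.hasSum_norm_sq ψ))

/-- The isometry by which the splitter (with vacuum in all the other input ports) acts on the
signal mode: `|N⟩ ↦ ∑ m with ∑ j, m j = N, coeff m • |m⟩`. -/
def Splitter.isometry {ι : Type} [Fintype ι] (u : Splitter ι) :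
    Fock ℕ →ₗᵢ[ℂ] Fock (ι → ℕ) where
  toFun := u.image
  map_add' _ _ := lp.ext (funext fun _ => mul_add _ _ _)
  map_smul' _ _ := lp.ext (funext fun _ => mul_left_comm _ _ _)
  norm_map' := u.norm_image

/-- The density operator of the output ports when the input state is `ρ`. -/
def Splitter.output {ι : Type} [Fintype ι] (u : Splitter ι) (ρ : State) :
    Fock (ι → ℕ) →L[ℂ] Fock (ι → ℕ) :=
  u.isometry.toContinuousLinearMap ∘L ρ.op ∘L
    ContinuousLinearMap.adjoint u.isometry.toContinuousLinearMap

/-! ## Detectors -/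

/-- The binomial weight: the probability of `k` successes in `n` independent trials that each
succeed with probability `p`. -/
def binom (p : ℝ) (n k : ℕ) : ℝ := (n.choose k : ℝ) * p ^ k * (1 - p) ^ (n - k)

/-- The POVM element "OFF" of an ON-OFF detector of efficiency `κ` and dark count probability `ε`,
on `N` incident photons: no photon is detected and there is no dark count. -/
def offWeight (κ ε : ℝ) (N : ℕ) : ℝ := (1 - ε) * binom κ N 0

/-- The POVM element "exactly `k` clicks" of `n` ON-OFF detectors, with occupation numbers `m`. The
port `some j` leads to the `j`-th detector; the port `none` is not monitored (light that leaves
the array; its amplitude may be zero). -/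
def clickWeight {n : ℕ} (κ : Fin n → ℝ) (ε : ℝ) (k : ℕ) (m : Option (Fin n) → ℕ) : ℝ :=
  ∑ S ∈ (Finset.univ : Finset (Fin n)).powersetCard k,
    (∏ j ∈ S, (1 - offWeight (κ j) ε (m (some j)))) * ∏ j ∈ Sᶜ, offWeight (κ j) ε (m (some j))

/-- The probability that the multiplexed detector registers `k` clicks on the state `ρ`. -/
def clickProb {n : ℕ} (u : Splitter (Option (Fin n))) (κ : Fin n → ℝ) (ε : ℝ) (ρ : State)
    (k : ℕ) : ℝ :=
  traceDiag (u.output ρ) (clickWeight κ ε k)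

/-- The `h`-th moment of the number of clicks. -/
def clickMoment {n : ℕ} (u : Splitter (Option (Fin n))) (κ : Fin n → ℝ) (ε : ℝ) (ρ : State)
    (h : ℕ) : ℝ :=
  ∑ k ∈ Finset.range (n + 1), (k : ℝ) ^ h * clickProb u κ ε ρ k

/-- The overall efficiency `κ̄ = ∑ j, κ_j η_j`. -/
def effEfficiency {n : ℕ} (u : Splitter (Option (Fin n))) (κ : Fin n → ℝ) : ℝ :=
  ∑ j, κ j * u.ratio (some j)

/-- The POVM element "count `k`" of a photon-number-resolving detector of efficiency `κ` with an
independent dark count that is binomial with parameters `n` and `ε` (mean `n ε`), on `N`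
incident photons. -/
def pnrWeight (κ : ℝ) (n : ℕ) (ε : ℝ) (k N : ℕ) : ℝ :=
  ∑ ad ∈ Finset.HasAntidiagonal.antidiagonal k, binom κ N ad.1 * binom ε n ad.2

/-- The probability that this photon-number-resolving detector counts `k` on the state `ρ`. -/
def pnrProb (κ : ℝ) (n : ℕ) (ε : ℝ) (ρ : State) (k : ℕ) : ℝ :=
  traceDiag ρ.op (pnrWeight κ n ε k)

end

end MPNR

namespace MPNR

noncomputable section

/-! ## Binomial means -/

/-! Only the diagonal of `ρ` matters: each output basis vector `|m⟩` has a definite total `N = ∑ j,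
m j`, so both moments are averages over the photon-number distribution, and it suffices to compare
them at fixed `N`.

At fixed `N` the photons act like independent classical particles. The clicking set starts as the
random set of dark counts, and each photon adds detector `j` with probability `q j = κ j * η j`.
That this chain reproduces the Born rule (`sum_norm_coeff_sq_mul_moment`) is checked on the events
"no detector in `T` clicks": the multinomial theorem and the chain both give `(1 - ε) ^ |T| * (1 - ∑
j ∈ T, q j) ^ N`, and inclusion–exclusion recovers everything else.

One photon changes the mean of `f(|A|)` by that of `(κ̄ - ∑ j ∈ A, q j) * Δf(|A|)`, whereas for the
ideal detector the factor is `κ̄`. The discrepancy is the chance of hitting a detector that has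
already clicked, at most `|A| * c / n`. For `f(k) = k ^ h` the difference `Δf` involves only lower
powers, so strong induction on `h` and induction over the photons give an error of order `N * (1 +
N) ^ h * (1 + n * ε) ^ h / n` (`exists_abs_clickMean_sub_pnrMean_le`). Averaging over `ρ` uses
exactly the moment of order `h + 1`. -/

/-- The mean of `f` under the binomial distribution of parameters `n` and `p`. -/
def binomMean (p : ℝ) (n : ℕ) : (ℕ → ℝ) →ₗ[ℝ] ℝ :=
  ∑ i ∈ Finset.range (n + 1), binom p n i • LinearMap.proj i

lemma binomMean_apply (p : ℝ) (n : ℕ) (f : ℕ → ℝ) :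
    binomMean p n f = ∑ i ∈ Finset.range (n + 1), binom p n i * f i := by
  simp [binomMean]

lemma binom_nonneg {p : ℝ} (hp : p ∈ Set.Icc (0 : ℝ) 1) (n k : ℕ) : 0 ≤ binom p n k := by
  have h0 := hp.1
  have h1 := sub_nonneg.2 hp.2
  unfold binom
  positivity

lemma binom_eq_zero {p : ℝ} {n k : ℕ} (h : n < k) : binom p n k = 0 := by
  simp [binom, Nat.choose_eq_zero_of_lt h]

lemma binom_succ_zero (p : ℝ) (n : ℕ) : binom p (n + 1) 0 = (1 - p) * binom p n 0 := by
  simp [binom, pow_succ']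

lemma binom_succ_succ (p : ℝ) (n k : ℕ) :
    binom p (n + 1) (k + 1) = p * binom p n k + (1 - p) * binom p n (k + 1) := by
  rcases lt_trichotomy k n with h | rfl | h
  · obtain ⟨d, rfl⟩ := Nat.exists_eq_add_of_lt h
    have e1 : k + d + 1 + 1 - (k + 1) = d + 1 := by omega
    have e2 : k + d + 1 - k = d + 1 := by omega
    have e3 : k + d + 1 - (k + 1) = d := by omega
    simp only [binom, e1, e2, e3, Nat.choose_succ_succ (k + d + 1) k, Nat.cast_add]
    ring
  · simp [binom, pow_succ']
  · rw [binom_eq_zero h, binom_eq_zero (by omega), binom_eq_zero (by omega)]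
    simp

lemma binomMean_zero (p : ℝ) (f : ℕ → ℝ) : binomMean p 0 f = f 0 := by
  simp [binomMean_apply, binom]

/-- Condition on one trial. Iterating this recursion replaces explicit binomial sums in all later
estimates. -/
lemma binomMean_succ (p : ℝ) (n : ℕ) (f : ℕ → ℝ) :
    binomMean p (n + 1) f = binomMean p n (fun k => f k + p * (f (k + 1) - f k)) := by
  have h : ∑ i ∈ Finset.range (n + 1), binom p n (i + 1) * f (i + 1) + binom p n 0 * f 0 =
      ∑ i ∈ Finset.range (n + 1), binom p n i * f i := by
    rw [← Finset.sum_range_succ' (fun i => binom p n i * f i), Finset.sum_range_succ,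
      binom_eq_zero (Nat.lt_succ_self n), zero_mul, add_zero]
  rw [binomMean_apply, binomMean_apply, Finset.sum_range_succ', binom_succ_zero]
  have e1 : ∀ i, binom p (n + 1) (i + 1) * f (i + 1) =
      p * (binom p n i * f (i + 1)) + (1 - p) * (binom p n (i + 1) * f (i + 1)) := fun i => by
    rw [binom_succ_succ]; ring
  have e2 : ∀ i, binom p n i * (f i + p * (f (i + 1) - f i)) =
      p * (binom p n i * f (i + 1)) + (1 - p) * (binom p n i * f i) := fun i => by ring
  simp only [e1, e2, Finset.sum_add_distrib, ← Finset.mul_sum]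
  rw [← h]
  ring

lemma binomMean_const (p : ℝ) (n : ℕ) (a : ℝ) : binomMean p n (fun _ => a) = a := by
  induction n with
  | zero => rw [binomMean_zero]
  | succ n ih => rw [binomMean_succ]; simpa using ih

lemma binomMean_mono {p : ℝ} (hp : p ∈ Set.Icc (0 : ℝ) 1) (n : ℕ) {f g : ℕ → ℝ}
    (h : ∀ i ≤ n, f i ≤ g i) : binomMean p n f ≤ binomMean p n g := by
  rw [binomMean_apply, binomMean_apply]
  exact Finset.sum_le_sum fun i hi => mul_le_mul_of_nonneg_left
    (h i (Nat.lt_succ_iff.1 (Finset.mem_range.1 hi))) (binom_nonneg hp n i)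

lemma add_one_pow_sub_pow (x : ℝ) (h : ℕ) :
    (x + 1) ^ h - x ^ h = ∑ i ∈ Finset.range h, (h.choose i : ℝ) * x ^ i := by
  rw [add_pow, Finset.sum_range_succ]
  simp [mul_comm]

/-- By `add_one_pow_sub_pow`, one trial raises a moment by `p` times a combination of lower ones,
which are controlled by strong induction. -/
lemma exists_binomMean_pow_le (h : ℕ) : ∃ C : ℝ, 0 ≤ C ∧ ∀ (p : ℝ) (n : ℕ),
    p ∈ Set.Icc (0 : ℝ) 1 →
      binomMean p n (fun k => ((k : ℝ) + 1) ^ h) ≤ C * (1 + n * p) ^ h := by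
  induction h using Nat.strong_induction_on with
  | _ h ih =>
  rcases Nat.eq_zero_or_pos h with rfl | hpos
  · exact ⟨1, zero_le_one, fun p n _ => by simp [binomMean_const]⟩
  obtain ⟨l, rfl⟩ : ∃ l, h = l + 1 := ⟨h - 1, by omega⟩
  choose! C hC0 hC using ih
  refine ⟨1 + ∑ i ∈ Finset.range (l + 1), ((l + 1).choose i : ℝ) * C i, ?_, fun p n hp => ?_⟩
  · have : 0 ≤ ∑ i ∈ Finset.range (l + 1), ((l + 1).choose i : ℝ) * C i :=
      Finset.sum_nonneg fun i hi =>
        mul_nonneg (Nat.cast_nonneg _) (hC0 i (Finset.mem_range.1 hi))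
    linarith
  set D := ∑ i ∈ Finset.range (l + 1), ((l + 1).choose i : ℝ) * C i with hD
  have hD0 : 0 ≤ D := Finset.sum_nonneg fun i hi =>
    mul_nonneg (Nat.cast_nonneg _) (hC0 i (Finset.mem_range.1 hi))
  have hp0 := hp.1
  -- The increment is bounded with the final `n` in place of `m`, so the trials add up linearly.
  have step : ∀ m ≤ n, binomMean p m (fun k => ((k : ℝ) + 1) ^ (l + 1)) ≤
      1 + m * (p * (D * (1 + n * p) ^ l)) := by
    intro m
    induction m with
    | zero => intro _; simp [binomMean_zero]
    | succ m ihm =>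
      intro hm
      have hmn : (m : ℝ) ≤ n := by exact_mod_cast (by omega : m ≤ n)
      have e : (fun k : ℕ => ((k : ℝ) + 1) ^ (l + 1) +
          p * ((((k + 1 : ℕ) : ℝ) + 1) ^ (l + 1) - ((k : ℝ) + 1) ^ (l + 1))) =
          (fun k : ℕ => ((k : ℝ) + 1) ^ (l + 1)) +
          p • ∑ i ∈ Finset.range (l + 1), ((l + 1).choose i : ℝ) •
            (fun k : ℕ => ((k : ℝ) + 1) ^ i) := by
        funext k
        simp only [Pi.add_apply, Pi.smul_apply, Finset.sum_apply, smul_eq_mul]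
        rw [← add_one_pow_sub_pow]
        push_cast
        ring
      rw [binomMean_succ, e, map_add, map_smul, map_sum]
      simp only [map_smul, smul_eq_mul]
      have hb : ∑ i ∈ Finset.range (l + 1), ((l + 1).choose i : ℝ) *
          binomMean p m (fun k : ℕ => ((k : ℝ) + 1) ^ i) ≤ D * (1 + n * p) ^ l := by
        rw [hD, Finset.sum_mul]
        refine Finset.sum_le_sum fun i hi => ?_
        have hil := Finset.mem_range.1 hi
        rw [mul_assoc]
        refine mul_le_mul_of_nonneg_left ?_ (Nat.cast_nonneg _)
        refine (hC i hil p m hp).trans (mul_le_mul_of_nonneg_left ?_ (hC0 i hil))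
        have hnp : 0 ≤ (n : ℝ) * p := by positivity
        calc (1 + m * p) ^ i ≤ (1 + n * p) ^ i := by gcongr
          _ ≤ (1 + n * p) ^ l := pow_le_pow_right₀ (by linarith) (by omega)
      have := mul_le_mul_of_nonneg_left hb hp0
      have := ihm (by omega)
      push_cast
      linarith
  refine (step n le_rfl).trans ?_
  have hnp : 0 ≤ (n : ℝ) * p := by positivity
  have h1 : (1 : ℝ) ≤ (1 + n * p) ^ (l + 1) := one_le_pow₀ (by linarith)
  have h2 : (n : ℝ) * p * (D * (1 + n * p) ^ l) ≤ (1 + n * p) * (D * (1 + n * p) ^ l) :=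
    mul_le_mul_of_nonneg_right (by linarith) (by positivity)
  rw [pow_succ'] at h1 ⊢
  nlinarith

/-- The mean of `f` under the sum of two independent binomial variables, of parameters `(N, κ)`
and `(n, ε)`. -/
def pnrMean (κ : ℝ) (N n : ℕ) (ε : ℝ) : (ℕ → ℝ) →ₗ[ℝ] ℝ where
  toFun f := binomMean κ N fun i => binomMean ε n fun j => f (i + j)
  map_add' f g := by
    rw [← map_add]
    congr 1
    funext i
    exact map_add (binomMean ε n) (fun j => f (i + j)) fun j => g (i + j)
  map_smul' a f := by
    rw [RingHom.id_apply, ← map_smul]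
    congr 1
    funext i
    exact map_smul (binomMean ε n) a fun j => f (i + j)

lemma pnrMean_apply (κ : ℝ) (N n : ℕ) (ε : ℝ) (f : ℕ → ℝ) :
    pnrMean κ N n ε f = binomMean κ N fun i => binomMean ε n fun j => f (i + j) := rfl

lemma pnrMean_zero (κ : ℝ) (n : ℕ) (ε : ℝ) (f : ℕ → ℝ) :
    pnrMean κ 0 n ε f = binomMean ε n f := by
  simp [pnrMean_apply, binomMean_zero]

lemma pnrMean_succ (κ : ℝ) (N n : ℕ) (ε : ℝ) (f : ℕ → ℝ) :
    pnrMean κ (N + 1) n ε f = pnrMean κ N n ε (fun k => f k + κ * (f (k + 1) - f k)) := by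
  rw [pnrMean_apply, pnrMean_apply, binomMean_succ]
  congr 1
  funext i
  have : (fun j => f (i + j) + κ * (f (i + j + 1) - f (i + j))) =
      (fun j => f (i + j)) + κ • ((fun j => f (i + 1 + j)) - fun j => f (i + j)) := by
    funext j
    simp [add_right_comm]
  rw [this, map_add, map_smul, map_sub, smul_eq_mul]

lemma pnrMean_pow_nonneg {κ ε : ℝ} (hκ : κ ∈ Set.Icc (0 : ℝ) 1) (hε : ε ∈ Set.Icc (0 : ℝ) 1)
    (N n h : ℕ) : 0 ≤ pnrMean κ N n ε fun k => (k : ℝ) ^ h := by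
  rw [← binomMean_const κ N 0, pnrMean_apply]
  refine binomMean_mono hκ N fun i _ => ?_
  rw [← binomMean_const ε n 0]
  exact binomMean_mono hε n fun j _ => by positivity

lemma pnrMean_pow_le {κ ε : ℝ} (hκ : κ ∈ Set.Icc (0 : ℝ) 1) (hε : ε ∈ Set.Icc (0 : ℝ) 1)
    (N n h : ℕ) : pnrMean κ N n ε (fun k => (k : ℝ) ^ h) ≤ ((N : ℝ) + n) ^ h := by
  rw [← binomMean_const κ N (((N : ℝ) + n) ^ h), pnrMean_apply]
  refine binomMean_mono hκ N fun i hi => ?_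
  rw [← binomMean_const ε n (((N : ℝ) + n) ^ h)]
  refine binomMean_mono hε n fun j hj => ?_
  have : ((i + j : ℕ) : ℝ) ≤ N + n := by exact_mod_cast (by omega : i + j ≤ N + n)
  gcongr

lemma pnrWeight_nonneg {κ ε : ℝ} (hκ : κ ∈ Set.Icc (0 : ℝ) 1) (hε : ε ∈ Set.Icc (0 : ℝ) 1)
    (n k N : ℕ) : 0 ≤ pnrWeight κ n ε k N :=
  Finset.sum_nonneg fun _ _ => mul_nonneg (binom_nonneg hκ _ _) (binom_nonneg hε _ _)

/-- The double sum has finite support; grouping it by `i + j = k` yields the convolution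
`pnrWeight`. -/
lemma hasSum_mul_pnrWeight (κ ε : ℝ) (n N : ℕ) (f : ℕ → ℝ) :
    HasSum (fun k => f k * pnrWeight κ n ε k N) (pnrMean κ N n ε f) := by
  have hF : HasSum (fun ij : ℕ × ℕ => f (ij.1 + ij.2) * (binom κ N ij.1 * binom ε n ij.2))
      (pnrMean κ N n ε f) := by
    have e : pnrMean κ N n ε f = ∑ ij ∈ Finset.range (N + 1) ×ˢ Finset.range (n + 1),
        f (ij.1 + ij.2) * (binom κ N ij.1 * binom ε n ij.2) := by
      rw [pnrMean_apply, binomMean_apply, Finset.sum_product]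
      refine Finset.sum_congr rfl fun i _ => ?_
      rw [binomMean_apply, Finset.mul_sum]
      exact Finset.sum_congr rfl fun j _ => by ring
    rw [e]
    refine hasSum_sum_of_ne_finset_zero fun ij hij => ?_
    simp only [Finset.mem_product, Finset.mem_range, not_and_or, not_lt] at hij
    rcases hij with h | h
    · rw [binom_eq_zero (by omega : N < ij.1)]; simp
    · rw [binom_eq_zero (by omega : n < ij.2)]; simp
  rw [← Finset.HasAntidiagonal.sigmaAntidiagonalEquivProd.hasSum_iff] at hF
  refine hF.sigma fun k => ?_
  rw [pnrWeight, Finset.mul_sum]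
  have e : ∀ x : Finset.HasAntidiagonal.antidiagonal k, x.1.1 + x.1.2 = k := fun x =>
    Finset.HasAntidiagonal.mem_antidiagonal.1 x.2
  simpa [e, Function.comp_def, Finset.HasAntidiagonal.sigmaAntidiagonalEquivProd] using
    Finset.hasSum (Finset.HasAntidiagonal.antidiagonal k)
      fun ij : ℕ × ℕ => f k * (binom κ N ij.1 * binom ε n ij.2)

/-! ## The random set of clicking detectors -/

section Click

variable {α : Type} [Fintype α] [DecidableEq α]

/-- The transition operator for one more photon, which is detected by `j` with probability
`q j`. -/
def clickStep (q : α → ℝ) : (Finset α → ℝ) →ₗ[ℝ] (Finset α → ℝ) where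
  toFun G A := G A + ∑ j, q j * (G (insert j A) - G A)
  map_add' G H := by
    funext A
    simp only [Pi.add_apply]
    rw [add_add_add_comm, ← Finset.sum_add_distrib]
    congr 1
    exact Finset.sum_congr rfl fun j _ => by ring
  map_smul' a G := by
    funext A
    simp only [Pi.smul_apply, smul_eq_mul, RingHom.id_apply, mul_add, Finset.mul_sum]
    congr 1
    exact Finset.sum_congr rfl fun j _ => by ring

lemma clickStep_apply (q : α → ℝ) (G : Finset α → ℝ) (A : Finset α) :
    clickStep q G A = G A + ∑ j, q j * (G (insert j A) - G A) := rfl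

/-- The mean of `G` over the random set that contains each detector independently with probability
`ε`, together with the detectors that are hit by one of `N` photons. -/
def clickMean (q : α → ℝ) (ε : ℝ) (N : ℕ) : (Finset α → ℝ) →ₗ[ℝ] ℝ :=
  (∑ A : Finset α, (ε ^ A.card * (1 - ε) ^ Aᶜ.card) • LinearMap.proj A) ∘ₗ clickStep q ^ N

lemma clickMean_zero (q : α → ℝ) (ε : ℝ) (G : Finset α → ℝ) :
    clickMean q ε 0 G = ∑ A : Finset α, ε ^ A.card * (1 - ε) ^ Aᶜ.card * G A := by
  simp [clickMean]

lemma clickMean_succ (q : α → ℝ) (ε : ℝ) (N : ℕ) (G : Finset α → ℝ) :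
    clickMean q ε (N + 1) G = clickMean q ε N (clickStep q G) := by
  simp [clickMean, pow_succ]

lemma clickMean_zero_card (q : α → ℝ) (ε : ℝ) (f : ℕ → ℝ) :
    clickMean q ε 0 (fun A => f A.card) = binomMean ε (Fintype.card α) f := by
  rw [clickMean_zero, binomMean_apply, ← Finset.powerset_univ]
  simp only [Finset.card_compl]
  rw [Finset.sum_powerset_apply_card
    (fun k => ε ^ k * (1 - ε) ^ (Fintype.card α - k) * f k), Finset.card_univ]
  refine Finset.sum_congr rfl fun k _ => ?_
  rw [nsmul_eq_mul, binom]
  ring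

/-- When `∑ j, q j ≤ 1`, a step is an average: the photon is missed with the remaining probability.
-/
lemma clickStep_mono {q : α → ℝ} (hq : ∀ j, 0 ≤ q j) (hq1 : ∑ j, q j ≤ 1)
    {G H : Finset α → ℝ} (h : ∀ A, G A ≤ H A) (A : Finset α) :
    clickStep q G A ≤ clickStep q H A := by
  have e : ∀ F : Finset α → ℝ,
      clickStep q F A = (1 - ∑ j, q j) * F A + ∑ j, q j * F (insert j A) := fun F => by
    simp only [clickStep_apply, mul_sub, Finset.sum_sub_distrib, ← Finset.sum_mul]
    ring
  rw [e, e]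
  exact add_le_add (mul_le_mul_of_nonneg_left (h A) (by linarith))
    (Finset.sum_le_sum fun j _ => mul_le_mul_of_nonneg_left (h _) (hq j))

lemma clickMean_mono {q : α → ℝ} (hq : ∀ j, 0 ≤ q j) (hq1 : ∑ j, q j ≤ 1) {ε : ℝ}
    (hε : ε ∈ Set.Icc (0 : ℝ) 1) (N : ℕ) {G H : Finset α → ℝ} (h : ∀ A, G A ≤ H A) :
    clickMean q ε N G ≤ clickMean q ε N H := by
  induction N generalizing G H with
  | zero =>
    rw [clickMean_zero, clickMean_zero]
    have h0 := hε.1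
    have h1 := sub_nonneg.2 hε.2
    exact Finset.sum_le_sum fun A _ => mul_le_mul_of_nonneg_left (h A) (by positivity)
  | succ N ih =>
    rw [clickMean_succ, clickMean_succ]
    exact ih (clickStep_mono hq hq1 h)

/-- Only a photon detected outside `A` increases the count; the term `∑ j ∈ A, q j` is the sole
departure from `pnrMean_succ`. -/
lemma clickStep_card (q : α → ℝ) (f : ℕ → ℝ) (A : Finset α) :
    clickStep q (fun A => f A.card) A =
      f A.card + (∑ j, q j - ∑ j ∈ A, q j) * (f (A.card + 1) - f A.card) := by
  have e : ∀ j, q j * (f (insert j A).card - f A.card) =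
      if j ∈ Aᶜ then q j * (f (A.card + 1) - f A.card) else 0 := fun j => by
    by_cases h : j ∈ A
    · simp [h]
    · simp [h, Finset.card_insert_of_notMem h]
  rw [clickStep_apply, ← Finset.sum_compl_add_sum A q, add_sub_cancel_right, Finset.sum_mul]
  simp only [e, Finset.sum_ite_mem, Finset.univ_inter]

/-- Each photon adds at most one click to the binomial dark count. -/
lemma clickMean_card_le {q : α → ℝ} (hq : ∀ j, 0 ≤ q j) (hq1 : ∑ j, q j ≤ 1) {ε : ℝ}
    (hε : ε ∈ Set.Icc (0 : ℝ) 1) (N : ℕ) {f : ℕ → ℝ} (hf : Monotone f) :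
    clickMean q ε N (fun A => f A.card) ≤ binomMean ε (Fintype.card α) fun k => f (k + N) := by
  induction N generalizing f with
  | zero => exact (clickMean_zero_card q ε f).le
  | succ N ih =>
    have := ih (f := fun k => f (k + 1)) fun a b hab => hf (Nat.succ_le_succ hab)
    rw [clickMean_succ]
    refine (clickMean_mono hq hq1 hε N fun A => ?_).trans
      (this.trans_eq (by simp only [add_assoc]))
    rw [clickStep_card]
    have h1 : f A.card ≤ f (A.card + 1) := hf (Nat.le_succ _)
    have h2 : 0 ≤ ∑ j ∈ A, q j := Finset.sum_nonneg fun j _ => hq j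
    nlinarith

lemma exists_clickMean_pow_le (h : ℕ) : ∃ C : ℝ, 0 ≤ C ∧
    ∀ (α : Type) [Fintype α] [DecidableEq α] (q : α → ℝ) (ε : ℝ) (N : ℕ), (∀ j, 0 ≤ q j) →
      ∑ j, q j ≤ 1 → ε ∈ Set.Icc (0 : ℝ) 1 →
      clickMean q ε N (fun A => ((A.card : ℝ) + 1) ^ h) ≤
        C * (1 + N) ^ h * (1 + Fintype.card α * ε) ^ h := by
  obtain ⟨C, hC0, hC⟩ := exists_binomMean_pow_le h
  refine ⟨C, hC0, fun α _ _ q ε N hq hq1 hε => ?_⟩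
  have hm : Monotone fun k : ℕ => ((k : ℝ) + 1) ^ h := fun a b hab => by
    have : (a : ℝ) ≤ b := by exact_mod_cast hab
    dsimp only
    gcongr
  refine (clickMean_card_le hq hq1 hε N hm).trans ?_
  have h1 : binomMean ε (Fintype.card α) (fun k => (((k + N : ℕ) : ℝ) + 1) ^ h) ≤
      binomMean ε (Fintype.card α) (((1 + N : ℝ) ^ h) • fun k : ℕ => ((k : ℝ) + 1) ^ h) := by
    refine binomMean_mono hε _ fun i _ => ?_
    rw [Pi.smul_apply, smul_eq_mul, ← mul_pow]
    have : (0 : ℝ) ≤ N * i := by positivity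
    refine pow_le_pow_left₀ (by positivity) ?_ h
    push_cast
    linarith
  refine h1.trans ?_
  rw [map_smul, smul_eq_mul, mul_comm C, mul_assoc]
  exact mul_le_mul_of_nonneg_left (hC ε _ hε) (by positivity)

/-- The moments of the number of clicks and of the ideal counting statistics differ by `O(1 / n)`,
with an explicit dependence on the number of photons and on the mean dark count. -/
lemma exists_abs_clickMean_sub_pnrMean_le (c : ℝ) (h : ℕ) : ∃ C : ℝ, 0 ≤ C ∧
    ∀ (α : Type) [Fintype α] [DecidableEq α] (q : α → ℝ) (ε : ℝ) (N : ℕ), (∀ j, 0 ≤ q j) →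
      (∀ j, q j ≤ c / Fintype.card α) → ∑ j, q j ≤ 1 → ε ∈ Set.Icc (0 : ℝ) 1 →
      |clickMean q ε N (fun A => (A.card : ℝ) ^ h) -
          pnrMean (∑ j, q j) N (Fintype.card α) ε (fun k => (k : ℝ) ^ h)| ≤
        C * N * (1 + N) ^ h * ((1 + Fintype.card α * ε) ^ h / Fintype.card α) := by
  induction h using Nat.strong_induction_on with
  | _ h ih =>
  choose! C hC0 hC using ih
  obtain ⟨B, hB0, hB⟩ := exists_clickMean_pow_le h
  set S := ∑ i ∈ Finset.range h, (h.choose i : ℝ) * C i with hS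
  have hS0 : 0 ≤ S := Finset.sum_nonneg fun i hi =>
    mul_nonneg (Nat.cast_nonneg _) (hC0 i (Finset.mem_range.1 hi))
  -- `S` pays for the lower moments in the recursion `hrec`, and `|c| * 2 ^ h * B` for the mean of
  -- `loss`.
  refine ⟨S + |c| * 2 ^ h * B, by positivity, fun α _ _ q ε N hq hqc hq1 hε => ?_⟩
  have hε0 := hε.1
  set n := Fintype.card α with hn
  have hnε : 0 ≤ (n : ℝ) * ε := by positivity
  set κ := ∑ j, q j with hκ
  have hκ0 : 0 ≤ κ := Finset.sum_nonneg fun j _ => hq j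
  set d : ℕ → ℕ → ℝ := fun M i => clickMean q ε M (fun A => (A.card : ℝ) ^ i) -
    pnrMean κ M n ε (fun k => (k : ℝ) ^ i) with hd
  set loss : Finset α → ℝ := fun A =>
    (∑ j ∈ A, q j) * (((A.card : ℝ) + 1) ^ h - (A.card : ℝ) ^ h) with hloss
  have loss_nonneg : ∀ A, 0 ≤ loss A := fun A => by
    refine mul_nonneg (Finset.sum_nonneg fun j _ => hq j) (sub_nonneg.2 ?_)
    gcongr
    linarith
  have loss_le : ∀ A, loss A ≤ |c| * 2 ^ h / n * ((A.card : ℝ) + 1) ^ h := fun A => by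
    have h1 : ∑ j ∈ A, q j ≤ A.card * (|c| / n) := by
      rw [← nsmul_eq_mul]
      refine Finset.sum_le_card_nsmul _ _ _ fun j _ => (hqc j).trans ?_
      gcongr
      exact le_abs_self c
    -- The difference has degree below `h`, so the extra factor `|A|` still fits into degree `h`;
    -- the binomial coefficients sum to at most `2 ^ h`.
    have h2 : (A.card : ℝ) * (((A.card : ℝ) + 1) ^ h - (A.card : ℝ) ^ h) ≤
        2 ^ h * ((A.card : ℝ) + 1) ^ h := by
      rw [add_one_pow_sub_pow, Finset.mul_sum]
      have h3 : ∀ i ∈ Finset.range h, (A.card : ℝ) * ((h.choose i : ℝ) * (A.card : ℝ) ^ i) ≤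
          (h.choose i : ℝ) * ((A.card : ℝ) + 1) ^ h := fun i hi => by
        rw [mul_left_comm, ← pow_succ']
        refine mul_le_mul_of_nonneg_left ?_ (Nat.cast_nonneg _)
        calc (A.card : ℝ) ^ (i + 1) ≤ ((A.card : ℝ) + 1) ^ (i + 1) := by gcongr; linarith
          _ ≤ _ := pow_le_pow_right₀ (by linarith [(Nat.cast_nonneg A.card : (0:ℝ) ≤ _)])
            (Finset.mem_range.1 hi)
      refine (Finset.sum_le_sum h3).trans ?_
      rw [← Finset.sum_mul]
      refine mul_le_mul_of_nonneg_right ?_ (by positivity)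
      have h4 : ∑ i ∈ Finset.range (h + 1), (h.choose i : ℝ) = 2 ^ h := by
        exact_mod_cast Nat.sum_range_choose h
      rw [← h4]
      exact Finset.sum_le_sum_of_subset_of_nonneg
        (Finset.range_subset_range.2 (Nat.le_succ h)) fun _ _ _ => Nat.cast_nonneg _
    have h5 : 0 ≤ ((A.card : ℝ) + 1) ^ h - (A.card : ℝ) ^ h := by
      refine sub_nonneg.2 ?_
      gcongr
      linarith
    calc loss A ≤ A.card * (|c| / n) * (((A.card : ℝ) + 1) ^ h - (A.card : ℝ) ^ h) :=
          mul_le_mul_of_nonneg_right h1 h5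
      _ = |c| / n * (A.card * (((A.card : ℝ) + 1) ^ h - (A.card : ℝ) ^ h)) := by ring
      _ ≤ |c| / n * (2 ^ h * ((A.card : ℝ) + 1) ^ h) := by gcongr
      _ = _ := by ring
  have hrec : ∀ M, d (M + 1) h = d M h +
      κ * ∑ i ∈ Finset.range h, (h.choose i : ℝ) * d M i - clickMean q ε M loss := fun M => by
    have e1 : clickStep q (fun A => (A.card : ℝ) ^ h) = (fun A => (A.card : ℝ) ^ h) +
        κ • ∑ i ∈ Finset.range h, (h.choose i : ℝ) • (fun A : Finset α => (A.card : ℝ) ^ i) -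
        loss := by
      funext A
      rw [clickStep_card q (fun k => (k : ℝ) ^ h)]
      simp only [Pi.add_apply, Pi.sub_apply, Pi.smul_apply, Finset.sum_apply, smul_eq_mul, hloss]
      rw [← add_one_pow_sub_pow]
      push_cast
      ring
    have e2 : (fun k : ℕ => (k : ℝ) ^ h + κ * (((k + 1 : ℕ) : ℝ) ^ h - (k : ℝ) ^ h)) =
        (fun k : ℕ => (k : ℝ) ^ h) +
        κ • ∑ i ∈ Finset.range h, (h.choose i : ℝ) • (fun k : ℕ => (k : ℝ) ^ i) := by
      funext k
      simp only [Pi.add_apply, Pi.smul_apply, Finset.sum_apply, smul_eq_mul]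
      rw [← add_one_pow_sub_pow]
      push_cast
      ring
    simp only [hd]
    rw [clickMean_succ, pnrMean_succ, e1, e2]
    simp only [map_add, map_sub, map_smul, map_sum, smul_eq_mul, mul_sub,
      Finset.sum_sub_distrib]
    ring
  set R := (1 + (N : ℝ)) ^ h * ((1 + n * ε) ^ h / n) with hR
  have key : ∀ M ≤ N, |d M h| ≤ M * ((S + |c| * 2 ^ h * B) * R) := by
    intro M
    induction M with
    | zero =>
      intro _
      simp only [hd]
      rw [clickMean_zero_card q ε (fun k => (k : ℝ) ^ h), pnrMean_zero, ← hn]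
      simp
    | succ M ihM =>
      intro hM
      have hMN : (M : ℝ) + 1 ≤ N := by exact_mod_cast hM
      have hb1 : |κ * ∑ i ∈ Finset.range h, (h.choose i : ℝ) * d M i| ≤ S * R := by
        rw [abs_mul, abs_of_nonneg hκ0]
        refine (mul_le_of_le_one_left (abs_nonneg _) hq1).trans ?_
        refine (Finset.abs_sum_le_sum_abs _ _).trans ?_
        rw [hS, Finset.sum_mul]
        refine Finset.sum_le_sum fun i hi => ?_
        have hih := Finset.mem_range.1 hi
        rw [abs_mul, Nat.abs_cast, mul_assoc]
        refine mul_le_mul_of_nonneg_left ?_ (Nat.cast_nonneg _)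
        refine (hC i hih α q ε M hq hqc hq1 hε).trans ?_
        rw [mul_assoc, mul_assoc]
        refine mul_le_mul_of_nonneg_left ?_ (hC0 i hih)
        rw [← mul_assoc]
        -- Since `i < h`, the factor `M` from the lower-order error is absorbed into degree `h`;
        -- thus only one extra power of `N` arises overall.
        have : (M : ℝ) * (1 + M) ^ i ≤ (1 + N) ^ h :=
          calc (M : ℝ) * (1 + M) ^ i ≤ (1 + N) * (1 + N) ^ i := by gcongr <;> linarith
            _ = (1 + N) ^ (i + 1) := (pow_succ' _ _).symm
            _ ≤ (1 + N) ^ h := pow_le_pow_right₀ (by linarith [(Nat.cast_nonneg N : (0:ℝ) ≤ _)]) hih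
        have h2 : (1 + n * ε) ^ i ≤ (1 + n * ε) ^ h :=
          pow_le_pow_right₀ (by linarith) hih.le
        rw [hR]
        gcongr
      have hb2 : |clickMean q ε M loss| ≤ |c| * 2 ^ h * B * R := by
        have h0 : 0 ≤ clickMean q ε M loss := by
          rw [← map_zero (clickMean q ε M)]
          exact clickMean_mono hq hq1 hε M loss_nonneg
        rw [abs_of_nonneg h0]
        have h1 := clickMean_mono (H := (|c| * 2 ^ h / n) • fun A : Finset α =>
          ((A.card : ℝ) + 1) ^ h) hq hq1 hε M loss_le
        rw [map_smul, smul_eq_mul] at h1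
        refine h1.trans ?_
        calc |c| * 2 ^ h / n * clickMean q ε M (fun A => ((A.card : ℝ) + 1) ^ h)
            ≤ |c| * 2 ^ h / n * (B * (1 + N) ^ h * (1 + n * ε) ^ h) := by
              refine mul_le_mul_of_nonneg_left ((hB α q ε M hq hq1 hε).trans ?_) (by positivity)
              gcongr
              linarith
          _ = _ := by rw [hR]; ring
      rw [hrec]
      have h3 := abs_sub (d M h + κ * ∑ i ∈ Finset.range h, (h.choose i : ℝ) * d M i)
        (clickMean q ε M loss)
      have h4 := abs_add_le (d M h) (κ * ∑ i ∈ Finset.range h, (h.choose i : ℝ) * d M i)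
      have h5 := ihM (by omega)
      push_cast
      linarith
  refine (key N le_rfl).trans_eq ?_
  rw [hR]
  ring

end Click

/-! ### Inclusion–exclusion and avoidance probabilities -/

section Avoid

variable {α : Type} [Fintype α] [DecidableEq α]

lemma prod_one_sub_mul_prod_compl (x : α → ℝ) (S : Finset α) :
    (∏ j ∈ S, (1 - x j)) * ∏ j ∈ Sᶜ, x j =
      ∑ T ∈ S.powerset, (-1) ^ T.card * ∏ j ∈ T ∪ Sᶜ, x j := by
  rw [Finset.prod_sub, Finset.sum_mul]
  refine Finset.sum_congr rfl fun T hT => ?_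
  have hd : Disjoint T Sᶜ := disjoint_compl_right_iff.2 (Finset.mem_powerset.1 hT)
  rw [Finset.prod_union hd]
  simp [mul_assoc]

/-- The indicator of the sets that are disjoint from `T`. -/
def avoid (T A : Finset α) : ℝ := ∏ j ∈ T, if j ∉ A then 1 else 0

lemma avoid_eq (T A : Finset α) : avoid T A = if ∀ j ∈ T, j ∉ A then 1 else 0 := by
  rw [avoid, Finset.prod_ite_zero]
  simp

/-- This is `prod_one_sub_mul_prod_compl` for the indicators of `j ∉ A`. It makes the functions
`avoid T` span all functions of the clicking set. -/
lemma sum_avoid_eq_ite (S A : Finset α) :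
    ∑ T ∈ S.powerset, (-1) ^ T.card * avoid (T ∪ Sᶜ) A = if A = S then 1 else 0 := by
  simp only [avoid]
  rw [← prod_one_sub_mul_prod_compl]
  split_ifs with h
  · subst h
    rw [Finset.prod_eq_one fun j hj => by simp [hj],
      Finset.prod_eq_one fun j hj => by simp [Finset.mem_compl.1 hj], one_mul]
  · by_cases hSA : S ⊆ A
    · obtain ⟨j, hjA, hjS⟩ := Finset.exists_of_ssubset
        (Finset.ssubset_iff_subset_ne.2 ⟨hSA, Ne.symm h⟩)
      rw [Finset.prod_eq_zero (s := Sᶜ) (Finset.mem_compl.2 hjS) (by simp [hjA]), mul_zero]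
    · obtain ⟨j, hjS, hjA⟩ := Finset.not_subset.1 hSA
      rw [Finset.prod_eq_zero (s := S) hjS (by simp [hjA]), zero_mul]

/-- An eigenvector: `T` stays avoided exactly when the new photon is not detected in `T`. -/
lemma clickStep_avoid (q : α → ℝ) (T : Finset α) :
    clickStep q (avoid T) = (1 - ∑ j ∈ T, q j) • avoid T := by
  funext A
  have e : ∀ j, q j * (avoid T (insert j A) - avoid T A) =
      if j ∈ T then -(q j * avoid T A) else 0 := fun j => by
    split_ifs with h
    · have : avoid T (insert j A) = 0 := Finset.prod_eq_zero h (by simp)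
      rw [this]; ring
    · have : avoid T (insert j A) = avoid T A := Finset.prod_congr rfl fun i hi => by
        have : i ≠ j := fun hij => h (hij ▸ hi)
        simp [this]
      rw [this]; ring
  rw [clickStep_apply]
  simp only [e, Finset.sum_ite_mem, Finset.univ_inter, Finset.sum_neg_distrib, ← Finset.sum_mul,
    Pi.smul_apply, smul_eq_mul]
  ring

lemma clickMean_avoid (q : α → ℝ) (ε : ℝ) (N : ℕ) (T : Finset α) :
    clickMean q ε N (avoid T) = (1 - ε) ^ T.card * (1 - ∑ j ∈ T, q j) ^ N := by
  induction N with
  | zero =>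
    -- Expanding this product over subsets `A` enumerates the dark-count sets disjoint from `T`.
    have h := Finset.prod_add (fun j => if j ∉ T then ε else 0) (fun _ => 1 - ε)
      (Finset.univ : Finset α)
    have e : ∀ j, (if j ∉ T then ε else 0) + (1 - ε) = if j ∈ T then 1 - ε else 1 := fun j => by
      by_cases h : j ∈ T <;> simp [h]
    simp only [e, Finset.prod_ite_mem, Finset.univ_inter, Finset.prod_const,
      Finset.prod_ite_zero, Finset.powerset_univ] at h
    rw [h, clickMean_zero, pow_zero, mul_one]
    refine Finset.sum_congr rfl fun A _ => ?_
    rw [avoid_eq, ← Finset.compl_eq_univ_sdiff]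
    have : (∀ j ∈ T, j ∉ A) ↔ ∀ j ∈ A, j ∉ T :=
      ⟨fun h j hA hT => h j hT hA, fun h j hT hA => h j hA hT⟩
    simp only [this]
    split_ifs <;> ring
  | succ N ih =>
    rw [clickMean_succ, clickStep_avoid, map_smul, ih, smul_eq_mul]
    ring

lemma clickMean_eq_sum (q : α → ℝ) (ε : ℝ) (N : ℕ) (G : Finset α → ℝ) :
    clickMean q ε N G = ∑ S, G S * ∑ T ∈ S.powerset, (-1) ^ T.card *
      ((1 - ε) ^ (T ∪ Sᶜ).card * (1 - ∑ j ∈ T ∪ Sᶜ, q j) ^ N) := by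
  have hG : G = ∑ S, G S • ∑ T ∈ S.powerset, ((-1 : ℝ) ^ T.card) • avoid (T ∪ Sᶜ) := by
    funext A
    simp only [Finset.sum_apply, Pi.smul_apply, smul_eq_mul, sum_avoid_eq_ite]
    simp
  conv_lhs => rw [hG]
  simp only [map_sum, map_smul, smul_eq_mul, clickMean_avoid]

end Avoid

/-! ## The output of the splitter -/

lemma diagEntry_nonneg (ρ : State) (N : ℕ) : 0 ≤ diagEntry ρ.op N :=
  ρ.pos.re_inner_nonneg_right (ket N)

lemma inner_ket {X : Type} (x : X) (ψ : Fock X) : inner ℂ (ket x) ψ = ψ x := by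
  classical
  have := lp.inner_single_left (𝕜 := ℂ) x (1 : ℂ) ψ
  rw [ket]
  convert this using 1
  simp

section Output

variable {ι : Type} [Fintype ι] (u : Splitter ι) (ρ : State)

lemma Splitter.adjoint_isometry_ket (m : ι → ℕ) :
    ContinuousLinearMap.adjoint u.isometry.toContinuousLinearMap (ket m) =
      (starRingEnd ℂ) (u.coeff m) • ket (∑ j, m j) := by
  refine ext_inner_right ℂ fun ψ => ?_
  rw [ContinuousLinearMap.adjoint_inner_left, inner_ket, inner_smul_left, inner_ket,
    Complex.conj_conj]
  rfl

/-- The adjoint sends `|m⟩` to a multiple of one number state, so no coherence of `ρ` enters. -/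
lemma Splitter.diagEntry_output (m : ι → ℕ) :
    diagEntry (u.output ρ) m = ‖u.coeff m‖ ^ 2 * diagEntry ρ.op (∑ j, m j) := by
  rw [diagEntry, Splitter.output, ContinuousLinearMap.comp_apply, ContinuousLinearMap.comp_apply,
    ← ContinuousLinearMap.adjoint_inner_left, u.adjoint_isometry_ket, map_smul, inner_smul_left,
    inner_smul_right, Complex.conj_conj, ← mul_assoc, Complex.mul_conj, diagEntry,
    Complex.normSq_eq_norm_sq]
  exact RCLike.re_ofReal_mul _ _

lemma Splitter.norm_coeff_sq (m : ι → ℕ) :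
    ‖u.coeff m‖ ^ 2 = (Nat.multinomial Finset.univ m : ℝ) * ∏ j, u.ratio j ^ m j := by
  rw [Splitter.coeff, norm_mul, mul_pow, Complex.norm_real, Real.norm_eq_abs, sq_abs,
    Real.sq_sqrt (Nat.cast_nonneg _), norm_prod, ← Finset.prod_pow]
  congr 1
  refine Finset.prod_congr rfl fun j _ => ?_
  rw [Splitter.ratio, norm_pow, ← pow_mul, ← pow_mul, mul_comm]

lemma Splitter.diagEntry_output_nonneg (m : ι → ℕ) : 0 ≤ diagEntry (u.output ρ) m := by
  rw [u.diagEntry_output]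
  exact mul_nonneg (by positivity) (diagEntry_nonneg ρ _)

lemma Splitter.summable_diagEntry_output : Summable (diagEntry (u.output ρ)) := by
  have hs : ∀ N, ‖((Real.sqrt (diagEntry ρ.op N) : ℝ) : ℂ)‖ ^ 2 = diagEntry ρ.op N := fun N => by
    rw [Complex.norm_real, Real.norm_eq_abs, sq_abs, Real.sq_sqrt (diagEntry_nonneg ρ N)]
  -- A pure state with the photon statistics of `ρ`; norm preservation then gives summability.
  let ψ : Fock ℕ := ⟨fun N => ((Real.sqrt (diagEntry ρ.op N) : ℝ) : ℂ),
    memℓp_gen (by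
      simp only [ENNReal.toReal_ofNat, Real.rpow_ofNat, hs]
      exact ρ.trace_one.summable)⟩
  refine (u.hasSum_norm_sq ψ).summable.congr fun m => ?_
  rw [u.diagEntry_output, norm_mul, mul_pow, ← hs]

lemma Splitter.summable_diagEntry_output_mul {e : (ι → ℕ) → ℝ} {B : ℝ} (he : ∀ m, |e m| ≤ B) :
    Summable fun m => diagEntry (u.output ρ) m * e m := by
  refine Summable.of_norm_bounded ((u.summable_diagEntry_output ρ).mul_right B) fun m => ?_
  rw [norm_mul, Real.norm_of_nonneg (u.diagEntry_output_nonneg ρ m)]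
  exact mul_le_mul_of_nonneg_left (he m) (u.diagEntry_output_nonneg ρ m)

open Classical in
lemma Splitter.hasSum_traceDiag_output {e : (ι → ℕ) → ℝ}
    (he : Summable fun m => diagEntry (u.output ρ) m * e m) :
    HasSum (fun N => diagEntry ρ.op N *
        ∑ m ∈ (Finset.univ : Finset ι).piAntidiag N, ‖u.coeff m‖ ^ 2 * e m)
      (traceDiag (u.output ρ) e) := by
  let E := Equiv.sigmaFiberEquiv (fun m : ι → ℕ => ∑ j, m j)
  have h := he.hasSum
  rw [← E.hasSum_iff] at h
  refine h.sigma fun N => ?_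
  let E' : {m : ι → ℕ // ∑ j, m j = N} ≃ (Finset.univ : Finset ι).piAntidiag N :=
    Equiv.subtypeEquivRight fun m => by simp
  rw [Finset.mul_sum, ← E'.symm.hasSum_iff]
  have e1 : ∀ m : (Finset.univ : Finset ι).piAntidiag N, ∑ j, m.1 j = N := fun m =>
    (Finset.mem_piAntidiag.1 m.2).1
  have hf := Finset.hasSum ((Finset.univ : Finset ι).piAntidiag N) fun m =>
    diagEntry ρ.op N * (‖u.coeff m‖ ^ 2 * e m)
  refine hf.congr_fun fun m => ?_
  have e2 : E ⟨N, E'.symm m⟩ = m.1 := rfl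
  simp only [Function.comp_apply, e2, u.diagEntry_output, e1]
  ring

end Output

/-! ### The Born rule equals the classical photon chain -/

section Detectors

variable {n : ℕ} (u : Splitter (Option (Fin n))) (κ : Fin n → ℝ) (ε : ℝ)

lemma offWeight_eq (κ ε : ℝ) (N : ℕ) : offWeight κ ε N = (1 - ε) * (1 - κ) ^ N := by
  simp [offWeight, binom]

lemma offWeight_mem_Icc {κ ε : ℝ} (hκ : κ ∈ Set.Icc (0 : ℝ) 1) (hε : ε ∈ Set.Icc (0 : ℝ) 1)
    (N : ℕ) : offWeight κ ε N ∈ Set.Icc (0 : ℝ) 1 := by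
  have h0 := sub_nonneg.2 hκ.2
  have h1 := sub_nonneg.2 hε.2
  rw [offWeight_eq]
  exact ⟨by positivity, mul_le_one₀ (by linarith [hε.1]) (by positivity)
    (pow_le_one₀ h0 (by linarith [hκ.1]))⟩

/-- Multinomial theorem, with each portion `η_j` for `j ∈ T` damped by `1 - κ j`; the unmonitored
port is undamped. -/
lemma sum_norm_coeff_sq_mul_prod_offWeight (N : ℕ) (T : Finset (Fin n)) :
    ∑ m ∈ (Finset.univ : Finset (Option (Fin n))).piAntidiag N,
      ‖u.coeff m‖ ^ 2 * ∏ j ∈ T, offWeight (κ j) ε (m (some j)) =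
    (1 - ε) ^ T.card * (1 - ∑ j ∈ T, κ j * u.ratio (some j)) ^ N := by
  let r : Option (Fin n) → ℝ := fun o => o.elim 1 fun j => if j ∈ T then 1 - κ j else 1
  have hr : ∑ o, u.ratio o * r o = 1 - ∑ j ∈ T, κ j * u.ratio (some j) := by
    have h1 := u.lossless
    have e : ∀ j, u.ratio (some j) * r (some j) =
        u.ratio (some j) - if j ∈ T then κ j * u.ratio (some j) else 0 := fun j => by
      simp only [r, Option.elim]
      split_ifs <;> ring
    rw [Fintype.sum_option] at h1 ⊢
    simp only [e, Finset.sum_sub_distrib, Finset.sum_ite_mem, Finset.univ_inter]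
    simp only [r, Option.elim, Splitter.ratio] at h1 ⊢
    linarith
  rw [← hr, Finset.sum_pow_eq_sum_piAntidiag, Finset.mul_sum]
  refine Finset.sum_congr rfl fun m _ => ?_
  have hm : ∏ o, r o ^ m o = ∏ j ∈ T, (1 - κ j) ^ m (some j) := by
    rw [Fintype.prod_option]
    simp only [r, Option.elim, one_pow, one_mul, ite_pow, Finset.prod_ite_mem, Finset.univ_inter]
  simp only [offWeight_eq, Finset.prod_mul_distrib, Finset.prod_const, mul_pow, hm,
    u.norm_coeff_sq]
  ring

lemma sum_pow_mul_clickWeight (h : ℕ) (m : Option (Fin n) → ℕ) :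
    ∑ k ∈ Finset.range (n + 1), (k : ℝ) ^ h * clickWeight κ ε k m =
      ∑ S : Finset (Fin n), (S.card : ℝ) ^ h *
        ∑ T ∈ S.powerset, (-1) ^ T.card *
          ∏ j ∈ T ∪ Sᶜ, offWeight (κ j) ε (m (some j)) := by
  rw [← Finset.powerset_univ, Finset.sum_powerset, Finset.card_univ, Fintype.card_fin]
  refine Finset.sum_congr rfl fun k _ => ?_
  rw [clickWeight, Finset.mul_sum]
  refine Finset.sum_congr rfl fun S hS => ?_
  rw [(Finset.mem_powersetCard.1 hS).2,
    prod_one_sub_mul_prod_compl fun j => offWeight (κ j) ε (m (some j))]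

lemma sum_norm_coeff_sq_mul_moment (h N : ℕ) :
    ∑ m ∈ (Finset.univ : Finset (Option (Fin n))).piAntidiag N,
      ‖u.coeff m‖ ^ 2 * ∑ k ∈ Finset.range (n + 1), (k : ℝ) ^ h * clickWeight κ ε k m =
    clickMean (fun j => κ j * u.ratio (some j)) ε N fun A => (A.card : ℝ) ^ h := by
  simp only [sum_pow_mul_clickWeight, clickMean_eq_sum, Finset.mul_sum]
  rw [Finset.sum_comm]
  refine Finset.sum_congr rfl fun S _ => ?_
  rw [Finset.sum_comm]
  refine Finset.sum_congr rfl fun T _ => ?_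
  rw [← sum_norm_coeff_sq_mul_prod_offWeight, Finset.mul_sum, Finset.mul_sum]
  exact Finset.sum_congr rfl fun m _ => by ring

lemma abs_clickWeight_le (hκ : ∀ j, κ j ∈ Set.Icc (0 : ℝ) 1) (hε : ε ∈ Set.Icc (0 : ℝ) 1)
    (k : ℕ) (m : Option (Fin n) → ℕ) :
    |clickWeight κ ε k m| ≤ ((Finset.univ : Finset (Fin n)).powersetCard k).card := by
  refine (Finset.abs_sum_le_sum_abs _ _).trans ?_
  refine (Finset.sum_le_card_nsmul _ _ 1 fun S _ => ?_).trans_eq (by simp)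
  have hx := fun j => offWeight_mem_Icc (hκ j) hε (m (some j))
  rw [abs_mul, Finset.abs_prod, Finset.abs_prod]
  refine mul_le_one₀ (Finset.prod_le_one (fun _ _ => abs_nonneg _) fun j _ => ?_)
    (Finset.prod_nonneg fun _ _ => abs_nonneg _)
    (Finset.prod_le_one (fun _ _ => abs_nonneg _) fun j _ => ?_)
  · exact abs_le.2 ⟨by linarith [(hx j).2], by linarith [(hx j).1]⟩
  · exact abs_le.2 ⟨by linarith [(hx j).1], (hx j).2⟩

lemma hasSum_clickMoment (ρ : State) (hκ : ∀ j, κ j ∈ Set.Icc (0 : ℝ) 1)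
    (hε : ε ∈ Set.Icc (0 : ℝ) 1) (h : ℕ) :
    HasSum (fun N => diagEntry ρ.op N *
        clickMean (fun j => κ j * u.ratio (some j)) ε N fun A => (A.card : ℝ) ^ h)
      (clickMoment u κ ε ρ h) := by
  have hk := fun k => u.summable_diagEntry_output_mul ρ (abs_clickWeight_le κ ε hκ hε k)
  have hs : HasSum (fun m => diagEntry (u.output ρ) m *
      ∑ k ∈ Finset.range (n + 1), (k : ℝ) ^ h * clickWeight κ ε k m)
      (clickMoment u κ ε ρ h) := by
    simp only [Finset.mul_sum]
    refine hasSum_sum fun k _ => ?_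
    simp only [mul_left_comm _ ((k : ℝ) ^ h)]
    exact (hk k).hasSum.mul_left _
  have := u.hasSum_traceDiag_output ρ hs.summable
  rw [traceDiag, hs.tsum_eq] at this
  convert this using 3 with N
  rw [← sum_norm_coeff_sq_mul_moment]
  -- The two `piAntidiag` differ only in their `DecidableEq` instance.
  refine Finset.sum_congr ?_ fun _ _ => rfl
  congr!

end Detectors

/-! ### Averaging over the photon number -/

section Comparison

variable {ρ : State}

lemma State.FiniteMoment.summable_add_one_pow {h : ℕ} (hρ : ρ.FiniteMoment h) :
    Summable fun N : ℕ => diagEntry ρ.op N * (1 + (N : ℝ)) ^ h := by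
  refine Summable.of_nonneg_of_le
    (fun N => mul_nonneg (diagEntry_nonneg ρ N) (by positivity)) (fun N => ?_)
    ((ρ.trace_one.summable.add hρ).mul_left (2 ^ (h - 1)))
  have := mul_le_mul_of_nonneg_left (add_pow_le zero_le_one (Nat.cast_nonneg N : (0 : ℝ) ≤ N) h)
    (diagEntry_nonneg ρ N)
  rw [one_pow] at this
  linarith

/-- All terms are nonnegative, so the sums over counts and photon numbers may be exchanged. -/
lemma hasSum_pow_mul_pnrProb {κ ε : ℝ} (hκ : κ ∈ Set.Icc (0 : ℝ) 1) (hε : ε ∈ Set.Icc (0 : ℝ) 1)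
    (n h : ℕ) {μ : ℕ → ℝ} (hμ : μ = fun N => pnrMean κ N n ε fun k => (k : ℝ) ^ h)
    (hs : Summable fun N => diagEntry ρ.op N * μ N) :
    HasSum (fun k : ℕ => (k : ℝ) ^ h * pnrProb κ n ε ρ k) (∑' N, diagEntry ρ.op N * μ N) := by
  subst hμ
  set F : ℕ × ℕ → ℝ := fun x =>
    diagEntry ρ.op x.1 * ((x.2 : ℝ) ^ h * pnrWeight κ n ε x.2 x.1) with hF
  have hrow : ∀ N, HasSum (fun k => F (N, k))
      (diagEntry ρ.op N * pnrMean κ N n ε fun k => (k : ℝ) ^ h) := fun N =>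
    (hasSum_mul_pnrWeight κ ε n N fun k => (k : ℝ) ^ h).mul_left _
  have hF0 : 0 ≤ F := fun x => mul_nonneg (diagEntry_nonneg ρ _)
    (mul_nonneg (by positivity) (pnrWeight_nonneg hκ hε _ _ _))
  have hFs : Summable F := (summable_prod_of_nonneg hF0).2
    ⟨fun N => (hrow N).summable, hs.congr fun N => (hrow N).tsum_eq.symm⟩
  have hsum : HasSum F (∑' N, diagEntry ρ.op N * pnrMean κ N n ε fun k => (k : ℝ) ^ h) := by
    have := hFs.hasSum
    rwa [← (this.prod_fiberwise hrow).tsum_eq] at this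
  rw [← (Equiv.prodComm ℕ ℕ).hasSum_iff] at hsum
  convert hsum.prod_fiberwise (fun k => (hsum.summable.prod_factor k).hasSum) using 2 with k
  rw [pnrProb, traceDiag, ← tsum_mul_left]
  refine tsum_congr fun N => ?_
  simp only [hF, Function.comp_apply, Equiv.prodComm_apply, Prod.swap_prod_mk]
  ring

end Comparison

end

end MPNR

open MPNR in
theorem theorem1 (ρ : State) (h : ℕ) (hρ : ρ.FiniteMoment (h + 1)) (c : ℝ) :
    ∃ C : ℝ, ∀ (n : ℕ) (u : Splitter (Option (Fin n))) (κ : Fin n → ℝ) (ε : ℝ),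
      0 < n →
      (∀ j, u.ratio (some j) ≤ c / n) →
      (∀ j, κ j ∈ Set.Icc (0 : ℝ) 1) →
      ε ∈ Set.Icc (0 : ℝ) 1 →
      Summable (fun k : ℕ => (k : ℝ) ^ h * pnrProb (effEfficiency u κ) n ε ρ k) ∧
      |clickMoment u κ ε ρ h -
          ∑' k : ℕ, (k : ℝ) ^ h * pnrProb (effEfficiency u κ) n ε ρ k| ≤
        C * (1 + n * ε) ^ h / n := by
  obtain ⟨C, hC0, hC⟩ := exists_abs_clickMean_sub_pnrMean_le c h
  have hsum := hρ.summable_add_one_pow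
  refine ⟨C * ∑' N : ℕ, diagEntry ρ.op N * (1 + (N : ℝ)) ^ (h + 1),
    fun n u κ ε _ hu hκ hε => ?_⟩
  have hη : ∀ j, 0 ≤ u.ratio j := fun j => sq_nonneg _
  have hq : ∀ j, 0 ≤ κ j * u.ratio (some j) := fun j => mul_nonneg (hκ j).1 (hη _)
  have hqη : ∀ j, κ j * u.ratio (some j) ≤ u.ratio (some j) := fun j =>
    mul_le_of_le_one_left (hη _) (hκ j).2
  have hq1 : ∑ j, κ j * u.ratio (some j) ≤ 1 := by
    have h1 : ∑ j, u.ratio j = 1 := u.lossless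
    rw [Fintype.sum_option] at h1
    linarith [Finset.sum_le_sum fun j (_ : j ∈ Finset.univ) => hqη j, hη none]
  have hκ' : effEfficiency u κ ∈ Set.Icc (0 : ℝ) 1 :=
    ⟨Finset.sum_nonneg fun j _ => hq j, hq1⟩
  set μ : ℕ → ℝ := fun N => pnrMean (effEfficiency u κ) N n ε fun k => (k : ℝ) ^ h with hμ
  -- The crude bound `M ≤ N + n` depends on `n`, which is harmless since only summability is needed.
  have hμs : Summable fun N => diagEntry ρ.op N * μ N := by
    refine Summable.of_nonneg_of_le
      (fun N => mul_nonneg (diagEntry_nonneg ρ N) (pnrMean_pow_nonneg hκ' hε N n h))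
      (fun N => ?_) (hsum.mul_left ((1 + (n : ℝ)) ^ h))
    have h1 : ((N : ℝ) + n) ^ h ≤ ((1 + n) * (1 + N)) ^ h := by
      gcongr
      nlinarith [mul_nonneg (Nat.cast_nonneg N : (0 : ℝ) ≤ N) (Nat.cast_nonneg n : (0 : ℝ) ≤ n)]
    have h2 : (1 + (N : ℝ)) ^ h ≤ (1 + N) ^ (h + 1) :=
      pow_le_pow_right₀ (by linarith [(Nat.cast_nonneg N : (0 : ℝ) ≤ N)]) (Nat.le_succ h)
    rw [mul_left_comm]
    refine mul_le_mul_of_nonneg_left ?_ (diagEntry_nonneg ρ N)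
    refine (pnrMean_pow_le hκ' hε N n h).trans (h1.trans ?_)
    rw [mul_pow]
    exact mul_le_mul_of_nonneg_left h2 (by positivity)
  have hM := hasSum_pow_mul_pnrProb hκ' hε n h hμ hμs
  have hK := hasSum_clickMoment u κ ε ρ hκ hε h
  refine ⟨hM.summable, ?_⟩
  rw [hM.tsum_eq]
  have hd := hK.sub hμs.hasSum
  have hb := hsum.hasSum.mul_left (C * ((1 + n * ε) ^ h / n))
  rw [← Real.norm_eq_abs, ← hd.tsum_eq]
  refine (tsum_of_norm_bounded hb fun N => ?_).trans_eq (by ring)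
  rw [← mul_sub, norm_mul, Real.norm_of_nonneg (diagEntry_nonneg ρ N), Real.norm_eq_abs,
    mul_left_comm]
  refine mul_le_mul_of_nonneg_left ?_ (diagEntry_nonneg ρ N)
  have hCN := hC (Fin n) (fun j => κ j * u.ratio (some j)) ε N hq
    (fun j => by rw [Fintype.card_fin]; exact (hqη j).trans (hu j)) hq1 hε
  rw [Fintype.card_fin] at hCN
  refine hCN.trans ?_
  have hX : 0 ≤ (1 + n * ε) ^ h / n := by
    have := hε.1
    positivity
  -- Here the moment of order `h + 1` enters the error bound.
  have hN : (N : ℝ) * (1 + N) ^ h ≤ (1 + N) ^ (h + 1) := by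
    rw [pow_succ']
    exact mul_le_mul_of_nonneg_right (by linarith) (by positivity)
  calc C * N * (1 + N) ^ h * ((1 + n * ε) ^ h / n)
      = C * ((1 + n * ε) ^ h / n) * (N * (1 + N) ^ h) := by ring
    _ ≤ C * ((1 + n * ε) ^ h / n) * (1 + N) ^ (h + 1) :=
        mul_le_mul_of_nonneg_left hN (mul_nonneg hC0 hX)
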